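/- Let $k$ be a perfect field of characteristic $p>0$, and let $S$ be a finitely generated submonoid of a lattice $\mathbb{Z}^n$. Put $M=\mathbb{Z}S$, and let $C=\mathbb{R}_{\ge 0}S$ be the cone generated by $S$. For a face $D$ of $C$ (including $C$ itself) write $\langle D\rangle=\mathbb{R}D$ for its linear span, $\mathrm{int}(D)$ for its relative interior, and $M_D=\mathbb{Z}(S\cap D)$. Assume that $S$ is seminormal, i.e. $S\cap \mathrm{int}(D)=M_D\cap\mathrm{int}(D)$ for every face $D$ of $C$, and let $R=k[S]$. A face $D$ is a relatively unsaturated face (RUF) if $D=C$, or if $D\neq C$ and $M_D\neq\bigcap_{D'\supsetneq D}M_{D'}\cap\langle D\rangle$, where $D'$ runs over the faces strictly containing $D$; a proper RUF is a RUF different from $C$. A $p$-RUF is a RUF $D$ such that $p$ divides the index $[M\cap\langle D\rangle:M_D]$. An ideal $I\subseteq R$ is called $\mathcal{C}$-fixed if $I=\sum_{e>0}\sum_{\phi\in\mathrm{Hom}_R(F^e_*R,R)}\phi(F^e_*I)$, where $F^e_*R$ is $R$ regarded as an $R$-module through the $e$-th iterate of Frobenius. The test ideal $\tau(R)$ is the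 smallest non-zero $\mathcal{C}$-fixed ideal, and the non-$F$-pure ideal $\sigma(R)$ is the largest $\mathcal{C}$-fixed ideal. Then: 1. Every $\mathcal{C}$-fixed ideal of $R$ is radical, and the intersection of any non-empty family of $\mathcal{C}$-fixed ideals is $\mathcal{C}$-fixed. 2. The test ideal $\tau(R)$ exists and $$\tau(R)=\langle x^u \mid u\in S \text{ and } u \text{ is not on any proper RUF}\rangle .$$ 3. The non-$F$-pure ideal $\sigma(R)$ exists and $$\sigma(R)=\langle x^u \mid u\in S\text{ and } u\text{ is not on any } p\text{-RUF}\rangle .$$ In 2 and 3, $\langle\cdots\rangle$ is the ideal generated by the given monomials; it is also their $k$-linear span. -/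

import Mathlib

/-! ## Cartier algebra: fixed ideals, test ideal, non-F-pure ideal -/

/-- An element of `Hom_R(F^e_* R, R)`: an additive map `φ : R → R` that is linear when `R` acts on
the source through the `p ^ e`-th power, i.e. `φ (r ^ (p ^ e) * s) = r * φ s`. -/
structure CartierMap (p : ℕ) (R : Type*) [CommRing R] (e : ℕ) where
  toFun : R →+ R
  map_pow_mul : ∀ r s : R, toFun (r ^ (p ^ e) * s) = r * toFun s

/-- The ideal `φ (F^e_* I)`, the set-theoretic image of `I` under `φ`. -/
def CartierMap.image {p : ℕ} {R : Type*} [CommRing R] {e : ℕ} (φ : CartierMap p R e)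
    (I : Ideal R) : Ideal R where
  carrier := φ.toFun '' (I : Set R)
  zero_mem' := ⟨0, I.zero_mem, map_zero _⟩
  add_mem' := by
    rintro _ _ ⟨x, hx, rfl⟩ ⟨y, hy, rfl⟩
    exact ⟨x + y, I.add_mem hx hy, map_add _ _ _⟩
  smul_mem' := by
    rintro r _ ⟨x, hx, rfl⟩
    exact ⟨r ^ (p ^ e) * x, I.mul_mem_left _ hx, φ.map_pow_mul r x⟩

/-- The ideal `I` is `𝒞`-fixed: `I = ∑_{e > 0} ∑_{φ ∈ Hom_R(F^e_* R, R)} φ (F^e_* I)`. -/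
def IsCartierFixed (p : ℕ) {R : Type*} [CommRing R] (I : Ideal R) : Prop :=
  I = ⨆ (e : ℕ) (_ : 0 < e) (φ : CartierMap p R e), φ.image I

/-- `τ` is the test ideal of `R`: the smallest non-zero `𝒞`-fixed ideal. -/
def IsTestIdeal (p : ℕ) {R : Type*} [CommRing R] (τ : Ideal R) : Prop :=
  IsLeast {I : Ideal R | I ≠ ⊥ ∧ IsCartierFixed p I} τ

/-- `σ` is the non-F-pure ideal of `R`: the largest `𝒞`-fixed ideal. -/
def IsNonFPureIdeal (p : ℕ) {R : Type*} [CommRing R] (σ : Ideal R) : Prop :=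
  IsGreatest {I : Ideal R | IsCartierFixed p I} σ

/-! ## The cone of a submonoid of `ℤⁿ`, its faces and their lattices -/

namespace AffineMonoidCone

/-- The inclusion `ℤⁿ → ℝⁿ`. -/
def toReal (n : ℕ) : (Fin n → ℤ) →+ (Fin n → ℝ) where
  toFun u i := (u i : ℝ)
  map_zero' := by ext; simp
  map_add' _ _ := by ext; simp

/-- The lattice `M = ℤS` generated by `S`. -/
def lattice {n : ℕ} (S : AddSubmonoid (Fin n → ℤ)) : AddSubgroup (Fin n → ℤ) :=
  AddSubgroup.closure (S : Set (Fin n → ℤ))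

/-- The cone `C = ℝ_{≥0} S`. It lies in `M ⊗ ℝ`, seen as the real span of `S` in `ℝⁿ`. -/
def cone {n : ℕ} (S : AddSubmonoid (Fin n → ℤ)) : PointedCone ℝ (Fin n → ℝ) :=
  PointedCone.hull ℝ (toReal n '' (S : Set (Fin n → ℤ)))

/-- `D` is a face of `C`. -/
def IsFace {n : ℕ} (S : AddSubmonoid (Fin n → ℤ)) (D : PointedCone ℝ (Fin n → ℝ)) : Prop :=
  D.IsFaceOf (cone S)

/-- The lattice `M_D = ℤ(S ∩ D)`. -/
def faceLattice {n : ℕ} (S : AddSubmonoid (Fin n → ℤ)) (D : PointedCone ℝ (Fin n → ℝ)) :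
    AddSubgroup (Fin n → ℤ) :=
  AddSubgroup.closure {u | u ∈ S ∧ toReal n u ∈ D}

/-- The integral points of the linear span `⟨D⟩ = ℝD`. -/
def spanPoints {n : ℕ} (D : PointedCone ℝ (Fin n → ℝ)) : AddSubgroup (Fin n → ℤ) :=
  (Submodule.span ℝ (D : Set (Fin n → ℝ))).toAddSubgroup.comap (toReal n)

/-- `S` is seminormal: `S ∩ int(D) = M_D ∩ int(D)` for every face `D` of `C`, where `int` is the
relative interior. -/
def IsSeminormal {n : ℕ} (S : AddSubmonoid (Fin n → ℤ)) : Prop :=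
  ∀ D : PointedCone ℝ (Fin n → ℝ), IsFace S D →
    ∀ u : Fin n → ℤ, toReal n u ∈ intrinsicInterior ℝ (D : Set (Fin n → ℝ)) →
      (u ∈ S ↔ u ∈ faceLattice S D)

/-- The face `D` satisfies `M_D = ⋂_{D ⊊ D'} M_{D'} ∩ ⟨D⟩`, over all faces `D'` strictly
containing `D`. -/
def IsRelativelySaturated {n : ℕ} (S : AddSubmonoid (Fin n → ℤ))
    (D : PointedCone ℝ (Fin n → ℝ)) : Prop :=
  faceLattice S D =
    (⨅ (D' : PointedCone ℝ (Fin n → ℝ)) (_ : IsFace S D' ∧ D < D'), faceLattice S D') ⊓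
      spanPoints D

/-- `D` is a relatively unsaturated face (RUF). By convention `C` itself is one. -/
def IsRUF {n : ℕ} (S : AddSubmonoid (Fin n → ℤ)) (D : PointedCone ℝ (Fin n → ℝ)) : Prop :=
  IsFace S D ∧ (D = cone S ∨ ¬ IsRelativelySaturated S D)

/-- `D` is a proper RUF, i.e. a RUF different from `C`. -/
def IsProperRUF {n : ℕ} (S : AddSubmonoid (Fin n → ℤ)) (D : PointedCone ℝ (Fin n → ℝ)) : Prop :=
  IsRUF S D ∧ D ≠ cone S

/-- `D` is a `p`-face: a face such that `p` divides the (finite) index `[M ∩ ⟨D⟩ : M_D]`. -/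
def IsPFace {n : ℕ} (S : AddSubmonoid (Fin n → ℤ)) (p : ℕ)
    (D : PointedCone ℝ (Fin n → ℝ)) : Prop :=
  IsFace S D ∧ p ∣ (faceLattice S D).relIndex (lattice S ⊓ spanPoints D)

/-- `D` is a `p`-RUF: a RUF that is also a `p`-face. -/
def IsPRUF {n : ℕ} (S : AddSubmonoid (Fin n → ℤ)) (p : ℕ)
    (D : PointedCone ℝ (Fin n → ℝ)) : Prop :=
  IsRUF S D ∧ IsPFace S p D

/-- The monomials `x^u` of `k[S]` with `u ∈ S` lying on no `D` that satisfies `P`. -/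
def monomialsOff (k : Type*) [Field k] {n : ℕ} (S : AddSubmonoid (Fin n → ℤ))
    (P : PointedCone ℝ (Fin n → ℝ) → Prop) : Set (AddMonoidAlgebra k S) :=
  {f | ∃ u : S, (∀ D, P D → toReal n (u : Fin n → ℤ) ∉ D) ∧ f = AddMonoidAlgebra.single u 1}

end AffineMonoidCone

/-! Everything reduces to monomials, through an obstruction and a construction for Cartier maps.

Obstruction (`coeff_cartierMap_single_eq_zero`): let m lie in ⟨D⟩ and in M_{D'} for all larger faces
D', but not in M_D. For suitable s in S ∩ D, seminormality puts v + p^e(m+s) in S as soon as v is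
off D or p^e m is in M_D. Then p^e-linearity gives φ(x^{v+p^e(m+s)}) = x^{m+s} φ(x^v), so a term x^w
of φ(x^v) with w on D would put m+s+w in S ∩ D, hence m in M_D. The first case shows that the ideal
off the proper RUFs is stable; the second, applied at a maximal p-face, shows that all images are
supported off the p-faces.

Construction (`exists_monomial_cartierMap`): since k is perfect, x^t ↦ x^{(t+b)/p^e} is a Cartier
map once every lattice point (t+b)/p^e with t in S lies in S. This holds if b in S is off the
p-faces. With b = (p^e-1)v it fixes x^v and, for large e, kills the other terms of a given element,
so fixed ideals are monomial; a variant gives radicality. With b = p^e u - v, u off the proper RUFs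
and e large, it sends x^v to x^u, so every non-zero fixed ideal contains x^u.

Finally, every p-face lies on a proper p-RUF (`exists_isPRUF`), so p-faces and p-RUFs exclude the
same monomials. -/

namespace PointedCone

/-! ### Minimal faces and relative interiors -/

variable {E : Type*} [AddCommGroup E] [Module ℝ E]

/-- The smallest face of the cone `C` containing the point `w` of `C`. -/
def minFace (C : PointedCone ℝ E) (w : E) : PointedCone ℝ E :=
  PointedCone.ofConeComb {y | y ∈ C ∧ ∃ N : ℝ, 0 ≤ N ∧ N • w - y ∈ C}
    ⟨0, C.zero_mem, 0, le_rfl, by simp⟩ (by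
      rintro x ⟨hx, N, hN, hxN⟩ y ⟨hy, N', hN', hyN⟩ a ha b hb
      refine ⟨C.add_mem (C.smul_mem ha hx) (C.smul_mem hb hy), a * N + b * N', by positivity, ?_⟩
      have : (a * N + b * N') • w - (a • x + b • y)
          = a • (N • w - x) + b • (N' • w - y) := by module
      rw [this]
      exact C.add_mem (C.smul_mem ha hxN) (C.smul_mem hb hyN))

theorem self_mem_minFace {C : PointedCone ℝ E} {w : E} (hw : w ∈ C) : w ∈ C.minFace w :=
  ⟨hw, 1, zero_le_one, by simp⟩

theorem mem_minFace_of_sub_mem {C : PointedCone ℝ E} {w y : E} (hy : y ∈ C) (h : w - y ∈ C) :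
    y ∈ C.minFace w :=
  ⟨hy, 1, zero_le_one, by simpa using h⟩

theorem isFaceOf_minFace (C : PointedCone ℝ E) (w : E) : (C.minFace w).IsFaceOf C where
  le _ hx := hx.1
  mem_of_smul_add_mem {x y a} hx hy ha := by
    rintro ⟨-, N, hN, h⟩
    refine ⟨hx, a⁻¹ * N, by positivity, ?_⟩
    have : (a⁻¹ * N) • w - x = a⁻¹ • ((N • w - (a • x + y)) + y) := by
      rw [sub_add_eq_sub_sub, sub_add_cancel, smul_sub, smul_smul, smul_smul,
        inv_mul_cancel₀ ha.ne', one_smul]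
    rw [this]
    exact C.smul_mem (by positivity) (C.add_mem h hy)

theorem IsFaceOf.minFace_le {C D : PointedCone ℝ E} (hD : D.IsFaceOf C) {w : E} (hw : w ∈ D) :
    C.minFace w ≤ D := by
  rintro y ⟨hy, N, hN, h⟩
  exact hD.mem_of_add_mem_right h hy (by simpa using D.smul_mem hN hw)

theorem minFace_mono {C : PointedCone ℝ E} {v w : E} (hv : v ∈ C) (h : w - v ∈ C) :
    C.minFace v ≤ C.minFace w :=
  (isFaceOf_minFace C w).minFace_le (mem_minFace_of_sub_mem hv h)

theorem exists_sub_of_mem_span {D : PointedCone ℝ E} {x : E}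
    (hx : x ∈ Submodule.span ℝ (D : Set E)) : ∃ a ∈ D, ∃ b ∈ D, x = a - b := by
  induction hx using Submodule.span_induction with
  | mem x h => exact ⟨x, h, 0, D.zero_mem, by simp⟩
  | zero => exact ⟨0, D.zero_mem, 0, D.zero_mem, by simp⟩
  | add x y _ _ hx hy =>
    obtain ⟨a, ha, b, hb, rfl⟩ := hx
    obtain ⟨c, hc, d, hd, rfl⟩ := hy
    exact ⟨a + c, D.add_mem ha hc, b + d, D.add_mem hb hd, by abel⟩
  | smul r x _ hx =>
    obtain ⟨a, ha, b, hb, rfl⟩ := hx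
    rcases le_total 0 r with hr | hr
    · exact ⟨r • a, D.smul_mem hr ha, r • b, D.smul_mem hr hb, by module⟩
    · exact ⟨(-r) • b, D.smul_mem (by linarith) hb, (-r) • a, D.smul_mem (by linarith) ha,
        by module⟩

theorem IsFaceOf.mem_of_mem_span {C D : PointedCone ℝ E} (hD : D.IsFaceOf C) {x : E} (hx : x ∈ C)
    (h : x ∈ Submodule.span ℝ (D : Set E)) : x ∈ D := by
  obtain ⟨a, ha, b, hb, rfl⟩ := exists_sub_of_mem_span h
  exact hD.mem_of_add_mem_left hx (hD.le hb) (by simpa using ha)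

/-- Some positive multiple εz of a relative interior point z of the face can be subtracted from w
within the face. Shrinking a neighbourhood of z by ε and translating it by w - εz gives one of w. -/
theorem mem_intrinsicInterior_minFace {V : Type*} [NormedAddCommGroup V] [NormedSpace ℝ V]
    [FiniteDimensional ℝ V] {C : PointedCone ℝ V} {w : V} (hw : w ∈ C) :
    w ∈ intrinsicInterior ℝ (C.minFace w : Set V) := by
  set D := C.minFace w with hD
  obtain ⟨z, hz⟩ := Set.Nonempty.intrinsicInterior D.convex ⟨0, D.zero_mem⟩
  have hzD : z ∈ D := intrinsicInterior_subset hz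
  obtain ⟨hzC, N, hN, hNz⟩ := hzD
  obtain ⟨ε, hε, hy⟩ : ∃ ε : ℝ, 0 < ε ∧ w - ε • z ∈ D := by
    have hD' : (N + 1) • w - z ∈ D :=
      ⟨by simpa [add_smul, add_sub_right_comm] using C.add_mem hNz hw, N + 1, by positivity,
        by simpa using hzC⟩
    refine ⟨(N + 1)⁻¹, by positivity, ?_⟩
    have := D.smul_mem (r := (N + 1)⁻¹) (by positivity) hD'
    rwa [smul_sub, smul_smul, inv_mul_cancel₀ (by positivity), one_smul] at this
  have hwD : w ∈ D := self_mem_minFace hw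
  have hwA := subset_affineSpan ℝ (D : Set V) hwD
  rw [mem_intrinsicInterior] at hz ⊢
  obtain ⟨z', hz', rfl⟩ := hz
  refine ⟨⟨w, hwA⟩, ?_, rfl⟩
  rw [mem_interior_iff_mem_nhds, Metric.mem_nhds_iff] at hz' ⊢
  obtain ⟨δ, hδ, hball⟩ := hz'
  refine ⟨ε * δ, by positivity, ?_⟩
  rintro ⟨x, hx⟩ hxw
  have hmem : (z' : V) + ε⁻¹ • (x - w) ∈ affineSpan ℝ (D : Set V) := by
    have := AffineSubspace.smul_vsub_vadd_mem (affineSpan ℝ (D : Set V)) ε⁻¹ hx hwA z'.2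
    simpa [add_comm] using this
  have hin : (⟨_, hmem⟩ : affineSpan ℝ (D : Set V)) ∈ Metric.ball z' δ := by
    rw [Metric.mem_ball, Subtype.dist_eq] at hxw ⊢
    simp only [dist_eq_norm] at hxw ⊢
    rw [add_sub_cancel_left, norm_smul, Real.norm_eq_abs, abs_of_pos (by positivity)]
    rwa [inv_mul_lt_iff₀ hε]
  have h1 : (z' : V) + ε⁻¹ • (x - w) ∈ D := hball hin
  have h2 : x = ε • ((z' : V) + ε⁻¹ • (x - w)) + (w - ε • (z' : V)) := by
    rw [smul_add, smul_smul, mul_inv_cancel₀ hε.ne', one_smul]; abel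
  change x ∈ D
  rw [h2]
  exact D.add_mem (D.smul_mem hε.le h1) hy

end PointedCone

namespace AffineMonoidCone

/-! ### Faces of the cone of a finitely generated monoid and their lattices -/

variable {n : ℕ} {S : AddSubmonoid (Fin n → ℤ)}

theorem toReal_nsmul (N : ℕ) (u : Fin n → ℤ) : toReal n (N • u) = (N : ℝ) • toReal n u := by
  rw [map_nsmul, Nat.cast_smul_eq_nsmul]

theorem toReal_mem_cone {u : Fin n → ℤ} (hu : u ∈ S) : toReal n u ∈ cone S :=
  Submodule.subset_span ⟨u, hu, rfl⟩

theorem isFace_minFace (S : AddSubmonoid (Fin n → ℤ)) (w : Fin n → ℝ) :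
    IsFace S ((cone S).minFace w) :=
  (cone S).isFaceOf_minFace w

theorem isFace_cone (S : AddSubmonoid (Fin n → ℤ)) : IsFace S (cone S) :=
  PointedCone.IsFaceOf.refl _

theorem mem_faceLattice {D : PointedCone ℝ (Fin n → ℝ)} {u : Fin n → ℤ} (hu : u ∈ S)
    (h : toReal n u ∈ D) : u ∈ faceLattice S D :=
  AddSubgroup.subset_closure ⟨hu, h⟩

theorem faceLattice_mono {D D' : PointedCone ℝ (Fin n → ℝ)} (h : D ≤ D') :
    faceLattice S D ≤ faceLattice S D' :=
  AddSubgroup.closure_mono fun _ hu => ⟨hu.1, h hu.2⟩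

theorem faceLattice_cone (S : AddSubmonoid (Fin n → ℤ)) :
    faceLattice S (cone S) = lattice S := by
  unfold faceLattice lattice
  congr 1
  ext u
  exact ⟨fun h => h.1, fun h => ⟨h, toReal_mem_cone h⟩⟩

theorem mem_spanPoints {D : PointedCone ℝ (Fin n → ℝ)} {u : Fin n → ℤ} :
    u ∈ spanPoints D ↔ toReal n u ∈ Submodule.span ℝ (D : Set (Fin n → ℝ)) := Iff.rfl

theorem mem_spanPoints_of_mem {D : PointedCone ℝ (Fin n → ℝ)} {u : Fin n → ℤ}
    (h : toReal n u ∈ D) : u ∈ spanPoints D :=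
  Submodule.subset_span h

theorem spanPoints_mono {D D' : PointedCone ℝ (Fin n → ℝ)} (h : D ≤ D') :
    spanPoints D ≤ spanPoints D' :=
  fun _ hu => Submodule.span_mono (SetLike.coe_subset_coe.2 h) hu

theorem faceLattice_le_spanPoints (S : AddSubmonoid (Fin n → ℤ))
    (D : PointedCone ℝ (Fin n → ℝ)) : faceLattice S D ≤ spanPoints D := by
  unfold faceLattice
  rw [AddSubgroup.closure_le]
  exact fun u hu => mem_spanPoints_of_mem hu.2

/-- Every element of the lattice of a face is a difference of elements of `S` in the face. -/
theorem exists_sub_of_mem_faceLattice {D : PointedCone ℝ (Fin n → ℝ)} {u : Fin n → ℤ}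
    (hu : u ∈ faceLattice S D) :
    ∃ a ∈ S, ∃ b ∈ S, toReal n a ∈ D ∧ toReal n b ∈ D ∧ u = a - b := by
  induction hu using AddSubgroup.closure_induction with
  | mem x h => exact ⟨x, h.1, 0, S.zero_mem, h.2, by simp, by simp⟩
  | zero => exact ⟨0, S.zero_mem, 0, S.zero_mem, by simp, by simp, by simp⟩
  | add x y _ _ hx hy =>
    obtain ⟨a, ha, b, hb, haD, hbD, rfl⟩ := hx
    obtain ⟨c, hc, d, hd, hcD, hdD, rfl⟩ := hy
    exact ⟨a + c, S.add_mem ha hc, b + d, S.add_mem hb hd,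
      by rw [map_add]; exact D.add_mem haD hcD, by rw [map_add]; exact D.add_mem hbD hdD, by abel⟩
  | neg x _ hx =>
    obtain ⟨a, ha, b, hb, haD, hbD, rfl⟩ := hx
    exact ⟨b, hb, a, ha, hbD, haD, by abel⟩

theorem exists_sub_of_mem_lattice {u : Fin n → ℤ} (hu : u ∈ lattice S) :
    ∃ a ∈ S, ∃ b ∈ S, u = a - b := by
  rw [← faceLattice_cone] at hu
  obtain ⟨a, ha, b, hb, -, -, h⟩ := exists_sub_of_mem_faceLattice hu
  exact ⟨a, ha, b, hb, h⟩

/-- The points of the cone are the nonnegative combinations of generators of the monoid. -/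
theorem exists_coeff_of_mem_cone {T : Finset (Fin n → ℤ)}
    (hT : AddSubmonoid.closure (T : Set (Fin n → ℤ)) = S) {x : Fin n → ℝ} (hx : x ∈ cone S) :
    ∃ c : (Fin n → ℤ) → ℝ, (∀ t, 0 ≤ c t) ∧ x = ∑ t ∈ T, c t • toReal n t := by
  classical
  induction hx using Submodule.span_induction with
  | mem x h =>
    obtain ⟨u, hu, rfl⟩ := h
    rw [← hT] at hu
    induction hu using AddSubmonoid.closure_induction with
    | mem x h =>
      refine ⟨Pi.single x 1, fun t => ?_, ?_⟩
      · rcases eq_or_ne t x with rfl | h <;> simp [*]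
      · rw [Finset.sum_eq_single_of_mem x h]
        · simp
        · intro b _ hb; simp [hb]
    | zero => exact ⟨0, fun _ => le_rfl, by simp⟩
    | add x y _ _ hx hy =>
      obtain ⟨c, hc, hx⟩ := hx
      obtain ⟨d, hd, hy⟩ := hy
      exact ⟨c + d, fun t => add_nonneg (hc t) (hd t), by
        simp [hx, hy, add_smul, Finset.sum_add_distrib]⟩
  | zero => exact ⟨0, fun _ => le_rfl, by simp⟩
  | add x y _ _ hx hy =>
    obtain ⟨c, hc, hx⟩ := hx
    obtain ⟨d, hd, hy⟩ := hy
    exact ⟨c + d, fun t => add_nonneg (hc t) (hd t), by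
      simp [hx, hy, add_smul, Finset.sum_add_distrib]⟩
  | smul r x _ hx =>
    obtain ⟨c, hc, hx⟩ := hx
    refine ⟨fun t => (r : ℝ) * c t, fun t => mul_nonneg r.2 (hc t), ?_⟩
    rw [hx, Finset.smul_sum]
    exact Finset.sum_congr rfl fun t _ => by rw [mul_smul]; rfl

open Classical in
/-- The points of a face are the nonnegative combinations of the generators on the face. -/
theorem IsFace.exists_coeff {T : Finset (Fin n → ℤ)}
    (hT : AddSubmonoid.closure (T : Set (Fin n → ℤ)) = S) {D : PointedCone ℝ (Fin n → ℝ)}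
    (hD : IsFace S D) {y : Fin n → ℝ} (hy : y ∈ D) :
    ∃ c : (Fin n → ℤ) → ℝ, (∀ t, 0 ≤ c t) ∧
      y = ∑ t ∈ T with toReal n t ∈ D, c t • toReal n t := by
  have hTS : ∀ t ∈ T, toReal n t ∈ cone S := fun t ht =>
    toReal_mem_cone (hT ▸ AddSubmonoid.subset_closure ht)
  obtain ⟨c, hc, hyc⟩ := exists_coeff_of_mem_cone hT (hD.le hy)
  refine ⟨c, hc, ?_⟩
  rw [Finset.sum_filter]
  refine hyc.trans (Finset.sum_congr rfl fun t ht => ?_)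
  split_ifs with htD
  · rfl
  rcases (hc t).eq_or_lt with h | h
  · rw [← h, zero_smul]
  -- A generator with positive coefficient is a summand of a point of the face, so it lies on the
  -- face.
  · refine absurd (hD.mem_of_smul_add_mem (hTS t ht)
      (y := ∑ s ∈ T.erase t, c s • toReal n s) ?_ h ?_) htD
    · exact Submodule.sum_mem _ fun s hs =>
        (cone S).smul_mem (hc s) (hTS s (Finset.mem_of_mem_erase hs))
    · rwa [Finset.add_sum_erase T (fun s => c s • toReal n s) ht, ← hyc]

open Classical in
/-- The sum of the generators that lie on a face is a relative interior point of the face. -/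
theorem IsFace.eq_minFace_sum {T : Finset (Fin n → ℤ)}
    (hT : AddSubmonoid.closure (T : Set (Fin n → ℤ)) = S) {D : PointedCone ℝ (Fin n → ℝ)}
    (hD : IsFace S D) :
    D = (cone S).minFace (toReal n (∑ t ∈ T with toReal n t ∈ D, t)) := by
  apply le_antisymm
  · intro y hy
    obtain ⟨c, hc, hyc⟩ := hD.exists_coeff hT hy
    refine ⟨hD.le hy, ∑ t ∈ T with toReal n t ∈ D, c t, Finset.sum_nonneg fun t _ => hc t, ?_⟩
    rw [hyc, map_sum, Finset.smul_sum, ← Finset.sum_sub_distrib]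
    refine Submodule.sum_mem _ fun t ht => ?_
    rw [← sub_smul]
    exact (cone S).smul_mem (sub_nonneg.2 (Finset.single_le_sum (fun t _ => hc t) ht))
      (hD.le (Finset.mem_filter.1 ht).2)
  · refine hD.minFace_le ?_
    rw [map_sum]
    exact Submodule.sum_mem _ fun t ht => (Finset.mem_filter.1 ht).2

theorem IsFace.exists_eq_minFace (hfg : S.FG) {D : PointedCone ℝ (Fin n → ℝ)} (hD : IsFace S D) :
    ∃ s ∈ S, toReal n s ∈ D ∧ D = (cone S).minFace (toReal n s) := by
  classical
  obtain ⟨T, hT⟩ := hfg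
  refine ⟨_, ?_, ?_, hD.eq_minFace_sum hT⟩
  · exact S.sum_mem fun t ht =>
      hT ▸ AddSubmonoid.subset_closure (Finset.mem_filter.1 ht).1
  · rw [map_sum]
    exact Submodule.sum_mem _ fun t ht => (Finset.mem_filter.1 ht).2

/-- A face is determined by the set of generators lying on it. -/
theorem finite_setOf_isFace (hfg : S.FG) : {D | IsFace S D}.Finite := by
  classical
  obtain ⟨T, hT⟩ := hfg
  refine Set.Finite.of_finite_image (f := fun D => T.filter fun t => toReal n t ∈ D)
    (T.powerset.finite_toSet.subset ?_) ?_
  · rintro _ ⟨D, -, rfl⟩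
    exact Finset.mem_coe.2 (Finset.mem_powerset.2 (Finset.filter_subset _ _))
  · intro D hD D' hD' h
    change T.filter (fun t => toReal n t ∈ D) = T.filter (fun t => toReal n t ∈ D') at h
    rw [IsFace.eq_minFace_sum hT hD, IsFace.eq_minFace_sum hT hD', h]

/-- A property of faces that fails somewhere fails at a face above which it holds. -/
theorem exists_maximal_isFace (hfg : S.FG) {P : PointedCone ℝ (Fin n → ℝ) → Prop}
    {D : PointedCone ℝ (Fin n → ℝ)} (hD : IsFace S D) (hP : ¬ P D) :
    ∃ D', D ≤ D' ∧ IsFace S D' ∧ ¬ P D' ∧ ∀ D'', IsFace S D'' → D' < D'' → P D'' := by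
  obtain ⟨D', h, hmax⟩ := Set.Finite.exists_le_maximal
    (s := {D | IsFace S D ∧ ¬ P D}) ((finite_setOf_isFace hfg).subset fun _ h => h.1) ⟨hD, hP⟩
  refine ⟨D', h, hmax.prop.1, hmax.prop.2, fun D'' hD'' hlt => ?_⟩
  by_contra hP''
  exact hlt.not_ge (hmax.le_of_ge ⟨hD'', hP''⟩ hlt.le)

/-- Membership of the elements of a seminormal monoid is decided by the face they generate. -/
theorem IsSeminormal.mem_of_mem_faceLattice (hS : IsSeminormal S) {w : Fin n → ℤ}
    (hw : toReal n w ∈ cone S) (h : w ∈ faceLattice S ((cone S).minFace (toReal n w))) : w ∈ S :=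
  (hS _ (isFace_minFace S _) w (PointedCone.mem_intrinsicInterior_minFace hw)).2 h

/-- An integral point of the span of a face is moved into the relative interior of the face by
adding an element of `S` on the face. -/
theorem IsFace.exists_add_mem (hfg : S.FG) {D : PointedCone ℝ (Fin n → ℝ)} (hD : IsFace S D)
    {m : Fin n → ℤ} (hm : m ∈ spanPoints D) :
    ∃ s ∈ S, toReal n s ∈ D ∧ toReal n (m + s) ∈ D ∧
      (cone S).minFace (toReal n (m + s)) = D := by
  obtain ⟨s, hs, hsD, hDs⟩ := hD.exists_eq_minFace hfg
  obtain ⟨a, ha, b, hb, hab⟩ := PointedCone.exists_sub_of_mem_span (mem_spanPoints.1 hm)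
  have hb' := hb
  rw [hDs] at hb'
  obtain ⟨-, N, hN, hNb⟩ := hb'
  obtain ⟨k, hk⟩ := exists_nat_ge N
  have hsC := hD.le hsD
  have hkb : (k : ℝ) • toReal n s - b ∈ cone S := by
    have : (k : ℝ) • toReal n s - b = (N • toReal n s - b) + (k - N) • toReal n s := by module
    rw [this]
    exact (cone S).add_mem hNb ((cone S).smul_mem (sub_nonneg.2 hk) hsC)
  have hkD : (k : ℝ) • toReal n s - b ∈ D :=
    hD.mem_of_mem_span hkb (Submodule.sub_mem _
      (Submodule.smul_mem _ _ (Submodule.subset_span hsD)) (Submodule.subset_span hb))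
  -- The first k copies of s absorb b; the extra copy keeps the sum in the relative interior of D.
  have heq : toReal n (m + (k + 1) • s) = (a + ((k : ℝ) • toReal n s - b)) + toReal n s := by
    rw [map_add, toReal_nsmul, hab]; push_cast; module
  have hmD : toReal n (m + (k + 1) • s) ∈ D := by
    rw [heq]
    exact D.add_mem (D.add_mem ha hkD) hsD
  refine ⟨(k + 1) • s, S.nsmul_mem hs _, ?_, hmD, le_antisymm (hD.minFace_le hmD) ?_⟩
  · rw [toReal_nsmul]; exact D.smul_mem (Nat.cast_nonneg _) hsD
  · conv_lhs => rw [hDs]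
    refine PointedCone.minFace_mono hsC ?_
    rw [heq, add_sub_cancel_right]
    exact (cone S).add_mem (hD.le ha) hkb

/-- The lattice of a face has full rank in the linear span of the face. -/
theorem IsFace.exists_nsmul_mem_faceLattice (hfg : S.FG) {D : PointedCone ℝ (Fin n → ℝ)}
    (hD : IsFace S D) {m : Fin n → ℤ} (hm : m ∈ spanPoints D) :
    ∃ N : ℕ, 0 < N ∧ N • m ∈ faceLattice S D := by
  classical
  by_contra! hcon
  set H : Submodule ℤ (Fin n → ℤ) := AddSubgroup.toIntSubmodule (faceLattice S D) with hH
  have hmt : H.mkQ m ∉ Submodule.torsion ℤ ((Fin n → ℤ) ⧸ H) := by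
    rw [Submodule.mem_torsion_iff]
    rintro ⟨⟨a, ha⟩, h⟩
    have ha0 : a ≠ 0 := nonZeroDivisors.ne_zero ha
    have h1 : a • m ∈ H := by
      rw [← Submodule.Quotient.mk_eq_zero]; exact h
    refine hcon a.natAbs (Int.natAbs_pos.2 ha0) ?_
    change a • m ∈ faceLattice S D at h1
    rcases Int.natAbs_eq a with h | h
    · rw [← natCast_zsmul, ← h]; exact h1
    · rw [← natCast_zsmul, ← neg_neg ((a.natAbs : ℤ)), ← h, neg_smul]; exact neg_mem h1
  -- Modulo torsion the quotient is a finitely generated torsion-free, hence free, ℤ-module; an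
  -- integral functional that kills M_D therefore detects m.
  have hne : (Submodule.torsion ℤ ((Fin n → ℤ) ⧸ H)).mkQ (H.mkQ m) ≠ 0 := by
    rwa [Submodule.mkQ_apply, Ne, Submodule.Quotient.mk_eq_zero]
  rw [Ne, ← Module.forall_dual_apply_eq_zero_iff ℤ, not_forall] at hne
  obtain ⟨f, hf⟩ := hne
  let g : (Fin n → ℤ) →ₗ[ℤ] ℤ := f ∘ₗ (Submodule.torsion ℤ ((Fin n → ℤ) ⧸ H)).mkQ ∘ₗ H.mkQ
  have hgH : ∀ u ∈ faceLattice S D, g u = 0 := by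
    intro u hu
    have : H.mkQ u = 0 := (Submodule.Quotient.mk_eq_zero H).2 hu
    simp only [g, LinearMap.comp_apply, this, map_zero]
  -- The real extension of this functional kills the generators on D, hence all of ⟨D⟩, which
  -- contains m.
  let gR : (Fin n → ℝ) →ₗ[ℝ] ℝ :=
    ∑ i, ((g (Pi.single i 1) : ℤ) : ℝ) • LinearMap.proj i
  have hgR : ∀ u, gR (toReal n u) = (g u : ℝ) := by
    intro u
    conv_rhs => rw [← Finset.univ_sum_single u]
    rw [map_sum]
    simp only [gR, LinearMap.sum_apply, LinearMap.smul_apply, LinearMap.proj_apply, smul_eq_mul]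
    push_cast
    refine Finset.sum_congr rfl fun i _ => ?_
    have : (Pi.single i (u i) : Fin n → ℤ) = u i • Pi.single i 1 := by
      rw [← Pi.single_smul]; simp
    rw [this, map_smul]
    simp [toReal, mul_comm]
  obtain ⟨T, hT⟩ := hfg
  have hker : Submodule.span ℝ (D : Set (Fin n → ℝ)) ≤ LinearMap.ker gR := by
    rw [Submodule.span_le]
    intro y hy
    obtain ⟨c, -, rfl⟩ := hD.exists_coeff hT hy
    refine Submodule.sum_mem _ fun t ht => Submodule.smul_mem _ _ ?_
    have ht' := Finset.mem_filter.1 ht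
    have htS : t ∈ S := hT ▸ AddSubmonoid.subset_closure ht'.1
    rw [LinearMap.mem_ker, hgR, hgH t (mem_faceLattice htS ht'.2), Int.cast_zero]
  have := hker (mem_spanPoints.1 hm)
  rw [LinearMap.mem_ker, hgR] at this
  exact hf (by exact_mod_cast this)

end AffineMonoidCone

namespace AffineMonoidCone

/-! ### Indices of face lattices, p-faces and RUFs -/

variable {n : ℕ} {S : AddSubmonoid (Fin n → ℤ)}

/-- The quotient is a finitely generated torsion group. Since an infinite index is recorded as 0,
which p divides, finiteness is needed before `IsPFace` has its meaning and Cauchy's theorem applies.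
-/
theorem IsFace.relIndex_ne_zero (hfg : S.FG) {D : PointedCone ℝ (Fin n → ℝ)} (hD : IsFace S D) :
    (faceLattice S D).relIndex (lattice S ⊓ spanPoints D) ≠ 0 := by
  set K := lattice S ⊓ spanPoints D
  have hfin : Finite (K ⧸ (faceLattice S D).addSubgroupOf K) := by
    have : Module.Finite ℤ K :=
      inferInstanceAs (Module.Finite ℤ (AddSubgroup.toIntSubmodule K))
    have : Module.Finite ℤ (K ⧸ (faceLattice S D).addSubgroupOf K) :=
      Module.Finite.of_surjective
        (QuotientAddGroup.mk' ((faceLattice S D).addSubgroupOf K)).toIntLinearMap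
        (QuotientAddGroup.mk'_surjective _)
    refine Module.finite_of_fg_torsion _ fun x => ?_
    obtain ⟨m, rfl⟩ := QuotientAddGroup.mk_surjective x
    obtain ⟨N, hN, h⟩ := hD.exists_nsmul_mem_faceLattice hfg m.2.2
    refine ⟨⟨(N : ℤ), mem_nonZeroDivisors_of_ne_zero (by exact_mod_cast hN.ne')⟩, ?_⟩
    change (N : ℤ) • (QuotientAddGroup.mk m : K ⧸ (faceLattice S D).addSubgroupOf K) = 0
    rw [← QuotientAddGroup.mk_zsmul, QuotientAddGroup.eq_zero_iff, AddSubgroup.mem_addSubgroupOf]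
    simpa using h
  exact AddSubgroup.index_ne_zero_of_finite

/-- A face `D` is a `p`-face if and only if `(M ∩ ⟨D⟩) / M_D` has `p`-torsion. -/
theorem IsFace.isPFace_iff (hfg : S.FG) {p : ℕ} [hp : Fact p.Prime]
    {D : PointedCone ℝ (Fin n → ℝ)} (hD : IsFace S D) :
    IsPFace S p D ↔
      ∃ m ∈ lattice S, m ∈ spanPoints D ∧ p • m ∈ faceLattice S D ∧ m ∉ faceLattice S D := by
  have h0 := hD.relIndex_ne_zero hfg
  unfold IsPFace
  rw [and_iff_right hD]
  unfold AddSubgroup.relIndex at h0 ⊢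
  set K := lattice S ⊓ spanPoints D with hK
  set H := (faceLattice S D).addSubgroupOf K with hH
  have : Finite (K ⧸ H) := @AddSubgroup.finite_quotient_of_finiteIndex _ _ H ⟨h0⟩
  constructor
  · intro h
    obtain ⟨x, hx⟩ := exists_prime_addOrderOf_dvd_card' (G := K ⧸ H) p h
    obtain ⟨m, rfl⟩ := QuotientAddGroup.mk_surjective x
    refine ⟨m, m.2.1, m.2.2, ?_, ?_⟩
    · have := addOrderOf_nsmul_eq_zero (QuotientAddGroup.mk m : K ⧸ H)
      rw [hx, ← QuotientAddGroup.mk_nsmul, QuotientAddGroup.eq_zero_iff] at this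
      simpa [hH, AddSubgroup.mem_addSubgroupOf] using this
    · intro hm
      have : (QuotientAddGroup.mk m : K ⧸ H) = 0 := by
        rw [QuotientAddGroup.eq_zero_iff]
        exact hm
      rw [this, addOrderOf_zero] at hx
      exact hp.out.one_lt.ne hx
  · rintro ⟨m, hm, hmD, hpm, hmn⟩
    let x : K ⧸ H := QuotientAddGroup.mk ⟨m, hm, hmD⟩
    have hx0 : x ≠ 0 := by
      intro h
      rw [QuotientAddGroup.eq_zero_iff] at h
      exact hmn h
    have hpx : p • x = 0 := by
      rw [← QuotientAddGroup.mk_nsmul, QuotientAddGroup.eq_zero_iff]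
      exact hpm
    rw [← addOrderOf_eq_prime hpx hx0]
    exact addOrderOf_dvd_natCard x

/-- If `D` is not a `p`-face, then `M_D` is `p`-saturated in `M ∩ ⟨D⟩`. -/
theorem IsFace.mem_faceLattice_of_pow_nsmul_mem (hfg : S.FG) {p : ℕ} [Fact p.Prime]
    {D : PointedCone ℝ (Fin n → ℝ)} (hD : IsFace S D) (hp : ¬ IsPFace S p D) {e : ℕ}
    {m : Fin n → ℤ} (hm : m ∈ lattice S) (hmD : m ∈ spanPoints D)
    (h : p ^ e • m ∈ faceLattice S D) : m ∈ faceLattice S D := by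
  rw [hD.isPFace_iff hfg] at hp
  push Not at hp
  induction e with
  | zero => simpa using h
  | succ e ih =>
    refine ih (hp _ (nsmul_mem hm _) (nsmul_mem hmD _) ?_)
    rwa [smul_smul, mul_comm, ← pow_succ]

theorem not_isPFace_cone (S : AddSubmonoid (Fin n → ℤ)) (p : ℕ) [hp : Fact p.Prime] :
    ¬ IsPFace S p (cone S) := by
  rintro ⟨-, h⟩
  rw [faceLattice_cone, AddSubgroup.relIndex_eq_one.2 inf_le_left] at h
  exact hp.out.one_lt.ne' (Nat.dvd_one.1 h)

theorem not_isRelativelySaturated_iff {D : PointedCone ℝ (Fin n → ℝ)} :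
    ¬ IsRelativelySaturated S D ↔
      ∃ m ∈ spanPoints D, (∀ D', IsFace S D' → D < D' → m ∈ faceLattice S D') ∧
        m ∉ faceLattice S D := by
  have hle : faceLattice S D ≤
      (⨅ (D' : PointedCone ℝ (Fin n → ℝ)) (_ : IsFace S D' ∧ D < D'), faceLattice S D') ⊓
        spanPoints D :=
    le_inf (le_iInf₂ fun D' h => faceLattice_mono h.2.le) (faceLattice_le_spanPoints S D)
  unfold IsRelativelySaturated
  rw [hle.ge_iff_eq.symm.not, SetLike.not_le_iff_exists]
  simp only [AddSubgroup.mem_inf, AddSubgroup.mem_iInf, and_imp]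
  exact ⟨fun ⟨m, ⟨h1, h2⟩, h3⟩ => ⟨m, h2, h1, h3⟩, fun ⟨m, h2, h1, h3⟩ => ⟨m, ⟨h1, h2⟩, h3⟩⟩

theorem IsFace.isRUF {D : PointedCone ℝ (Fin n → ℝ)} (hD : IsFace S D) {m : Fin n → ℤ}
    (hm : m ∈ spanPoints D) (h : ∀ D', IsFace S D' → D < D' → m ∈ faceLattice S D')
    (hmD : m ∉ faceLattice S D) : IsRUF S D :=
  ⟨hD, Or.inr (not_isRelativelySaturated_iff.2 ⟨m, hm, h, hmD⟩)⟩

theorem IsProperRUF.exists_mem {D : PointedCone ℝ (Fin n → ℝ)} (h : IsProperRUF S D) :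
    ∃ m ∈ spanPoints D, (∀ D', IsFace S D' → D < D' → m ∈ faceLattice S D') ∧
      m ∉ faceLattice S D :=
  not_isRelativelySaturated_iff.1 (h.1.2.resolve_left h.2)

/-- Every `p`-face lies on a face `D` such that some `m ∈ ⋂_{D ⊊ D'} M_{D'} ∩ ⟨D⟩` has
`p`-torsion image modulo `M_D`. -/
theorem IsPFace.exists_le (hfg : S.FG) {p : ℕ} [Fact p.Prime] {D : PointedCone ℝ (Fin n → ℝ)}
    (hD : IsPFace S p D) :
    ∃ D', D ≤ D' ∧ IsPFace S p D' ∧ ∃ m ∈ spanPoints D',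
      (∀ D'', IsFace S D'' → D' < D'' → m ∈ faceLattice S D'') ∧
      m ∉ faceLattice S D' ∧ p • m ∈ faceLattice S D' := by
  -- At a maximal p-face the larger faces have p-saturated lattices, so they contain m along with p
  -- • m.
  obtain ⟨D', hle, hD', hPD', hmax⟩ :=
    exists_maximal_isFace hfg (P := fun D => ¬ IsPFace S p D) hD.1 (not_not.2 hD)
  rw [not_not] at hPD'
  obtain ⟨m, hm, hmD, hpm, hmn⟩ := (hD'.isPFace_iff hfg).1 hPD'
  refine ⟨D', hle, hPD', m, hmD, fun D'' hD'' hlt => ?_, hmn, hpm⟩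
  refine hD''.mem_faceLattice_of_pow_nsmul_mem hfg (hmax D'' hD'' hlt) (e := 1) hm
    (spanPoints_mono hlt.le hmD) ?_
  rw [pow_one]
  exact faceLattice_mono hlt.le hpm

theorem IsPFace.exists_isPRUF (hfg : S.FG) {p : ℕ} [Fact p.Prime]
    {D : PointedCone ℝ (Fin n → ℝ)} (hD : IsPFace S p D) :
    ∃ D', D ≤ D' ∧ IsPRUF S p D' ∧ IsProperRUF S D' := by
  obtain ⟨D', hle, hD', m, hm, hmD, hmn, -⟩ := hD.exists_le hfg
  have hR := hD'.1.isRUF hm hmD hmn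
  exact ⟨D', hle, ⟨hR, hD'⟩, hR, fun h => not_isPFace_cone S p (h ▸ hD')⟩

/-- If no proper RUF contains the face `D`, then `M_D = M ∩ ⟨D⟩`. -/
theorem IsFace.mem_faceLattice_of_forall_not_isProperRUF (hfg : S.FG)
    {D : PointedCone ℝ (Fin n → ℝ)} (hD : IsFace S D)
    (h : ∀ D', D ≤ D' → ¬ IsProperRUF S D') {m : Fin n → ℤ} (hm : m ∈ lattice S)
    (hmD : m ∈ spanPoints D) : m ∈ faceLattice S D := by
  by_contra hmn
  obtain ⟨D', hle, hD', hPD', hmax⟩ := exists_maximal_isFace hfg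
    (P := fun D => m ∈ faceLattice S D) hD hmn
  refine h D' hle ⟨hD'.isRUF (spanPoints_mono hle hmD) hmax hPD', ?_⟩
  rintro rfl
  exact hPD' (by rwa [faceLattice_cone])

end AffineMonoidCone

namespace AffineMonoidCone

/-! ### Lattice points (t + b) / q that belong to the monoid -/

open Filter Topology

variable {n : ℕ} {S : AddSubmonoid (Fin n → ℤ)}

/-- For fixed `v`, an integral point of the form `(t - v) / q` with `t ∈ S` and `q` large lies in
the cone. -/
theorem eventually_toReal_mem_cone (hfg : S.FG) (v : Fin n → ℤ) :
    ∀ᶠ q : ℕ in atTop, ∀ t ∈ S, ∀ y : Fin n → ℤ, q • y = t - v → toReal n y ∈ cone S := by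
  obtain ⟨T, hT⟩ := hfg
  set L : ((Fin n → ℤ) → ℝ) → (Fin n → ℝ) := fun c => ∑ s ∈ T, c s • toReal n s with hL
  -- The zonotope of the generators is compact. Dividing the coefficients of t by q with remainder
  -- reduces the claim to points of Z + (-v) / q.
  set Z : Set (Fin n → ℝ) := L '' Set.univ.pi fun _ => Set.Icc 0 1 with hZ
  have hZcl : IsClosed Z := by
    refine IsCompact.isClosed ((isCompact_univ_pi fun _ => isCompact_Icc).image ?_)
    fun_prop
  have hTS : ∀ s ∈ T, toReal n s ∈ cone S := fun s hs =>
    toReal_mem_cone (hT ▸ AddSubmonoid.subset_closure hs)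
  have hZC : ∀ z ∈ Z, z ∈ cone S := by
    rintro _ ⟨c, hc, rfl⟩
    exact Submodule.sum_mem _ fun s hs => (cone S).smul_mem (hc s trivial).1 (hTS s hs)
  -- A bound on y - a independent of q leaves finitely many candidates; each one outside the closed
  -- set Z stays outside after adding v / q for large q.
  set R : Fin n → ℤ := fun j => ∑ s ∈ T, |s j| + |v j| with hR
  have hev : ∀ᶠ q : ℕ in atTop, ∀ y ∈ Set.Icc (-R) R,
      toReal n y + (q : ℝ)⁻¹ • toReal n v ∈ Z → toReal n y ∈ Z := by
    rw [eventually_all_finite (Set.finite_Icc _ _)]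
    intro y _
    by_cases hy : toReal n y ∈ Z
    · exact Eventually.of_forall fun _ _ => hy
    · have hlim : Tendsto (fun q : ℕ => toReal n y + (q : ℝ)⁻¹ • toReal n v) atTop
          (𝓝 (toReal n y)) := by
        have h1 : Tendsto (fun q : ℕ => (q : ℝ)⁻¹) atTop (𝓝 0) :=
          tendsto_inv_atTop_nhds_zero_nat
        simpa using (h1.smul_const (toReal n v)).const_add (toReal n y)
      filter_upwards [hlim.eventually (hZcl.isOpen_compl.mem_nhds hy)] with q hq h
      exact absurd h hq
  filter_upwards [hev, eventually_gt_atTop 0] with q hq hq0 t ht y hy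
  have hqR : (0 : ℝ) < q := by exact_mod_cast hq0
  rw [← hT, AddSubmonoid.mem_closure_finset] at ht
  obtain ⟨f, -, rfl⟩ := ht
  set a : Fin n → ℤ := ∑ s ∈ T, (f s / q) • s with ha
  have hsplit : ∑ s ∈ T, f s • s = q • a + ∑ s ∈ T, (f s % q) • s := by
    rw [ha, Finset.smul_sum, ← Finset.sum_add_distrib]
    refine Finset.sum_congr rfl fun s _ => ?_
    rw [smul_smul, ← add_smul, Nat.div_add_mod]
  have hy' : q • (y - a) = ∑ s ∈ T, (f s % q) • s - v := by
    rw [smul_sub, hy, hsplit]; abel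
  have haC : toReal n a ∈ cone S := by
    rw [ha, map_sum]
    exact Submodule.sum_mem _ fun s hs => by
      rw [toReal_nsmul]; exact (cone S).smul_mem (Nat.cast_nonneg _) (hTS s hs)
  have hbound : ∀ j, |(y - a) j| ≤ R j := by
    intro j
    have h1 := congrFun hy' j
    simp only [Pi.smul_apply, Pi.sub_apply, Finset.sum_apply] at h1
    simp only [nsmul_eq_mul] at h1
    have h2 : (q : ℤ) * |(y - a) j| ≤ q * R j := by
      have h3 : (q : ℤ) * |(y - a) j| = |∑ s ∈ T, ((f s % q : ℕ) : ℤ) * s j - v j| := by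
        rw [← h1, abs_mul, Nat.abs_cast, Pi.sub_apply]
      rw [h3]
      refine (abs_sub _ _).trans ?_
      rw [hR, mul_add, Finset.mul_sum]
      refine add_le_add ((Finset.abs_sum_le_sum_abs _ _).trans (Finset.sum_le_sum fun s _ => ?_)) ?_
      · rw [abs_mul, Nat.abs_cast]
        exact mul_le_mul_of_nonneg_right
          (by exact_mod_cast (Nat.mod_lt _ hq0).le) (abs_nonneg _)
      · exact le_mul_of_one_le_left (abs_nonneg _) (by exact_mod_cast hq0)
    exact le_of_mul_le_mul_left h2 (by exact_mod_cast hq0)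
  have hmem : toReal n (y - a) ∈ Z := by
    refine hq _ ⟨fun j => (abs_le.1 (hbound j)).1, fun j => (abs_le.1 (hbound j)).2⟩
      ⟨fun s => (q : ℝ)⁻¹ * ((f s % q : ℕ) : ℝ), fun s _ => ⟨by positivity, ?_⟩, ?_⟩
    · rw [inv_mul_le_iff₀ hqR, mul_one]
      exact_mod_cast (Nat.mod_lt _ hq0).le
    · have h1 : (q : ℝ) • toReal n (y - a) =
          ∑ s ∈ T, ((f s % q : ℕ) : ℝ) • toReal n s - toReal n v := by
        rw [← toReal_nsmul, hy', map_sub, map_sum]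
        simp only [toReal_nsmul]
      have h2 : toReal n (y - a) = (q : ℝ)⁻¹ •
          (∑ s ∈ T, ((f s % q : ℕ) : ℝ) • toReal n s - toReal n v) := by
        rw [← h1, smul_smul, inv_mul_cancel₀ hqR.ne', one_smul]
      rw [h2, hL, smul_sub, sub_add_cancel, Finset.smul_sum]
      exact Finset.sum_congr rfl fun s _ => by rw [mul_smul]
  have : toReal n y = toReal n (y - a) + toReal n a := by rw [← map_add, sub_add_cancel]
  rw [this]
  exact (cone S).add_mem (hZC _ hmem) haC

theorem toReal_mem_of_nsmul_mem {D : PointedCone ℝ (Fin n → ℝ)} {q : ℕ} (hq : 0 < q)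
    {w : Fin n → ℤ} (h : toReal n (q • w) ∈ D) : toReal n w ∈ D := by
  rw [toReal_nsmul] at h
  have hq' : (0 : ℝ) < q := by exact_mod_cast hq
  have := D.smul_mem (r := (q : ℝ)⁻¹) (by positivity) h
  rwa [smul_smul, inv_mul_cancel₀ hq'.ne', one_smul] at this

/-- If `b ∈ S` lies on no `p`-face, then the lattice points `(t + b) / p ^ e` with `t ∈ S` belong
to `S`. -/
theorem IsSeminormal.mem_of_pow_nsmul_eq_add (hS : IsSeminormal S) (hfg : S.FG) {p : ℕ}
    [hp : Fact p.Prime] {b : Fin n → ℤ} (hb : b ∈ S)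
    (hoff : ∀ D, IsPFace S p D → toReal n b ∉ D) {e : ℕ} {t w : Fin n → ℤ} (ht : t ∈ S)
    (hw : w ∈ lattice S) (h : p ^ e • w = t + b) : w ∈ S := by
  have hpe : 0 < p ^ e := pow_pos hp.out.pos e
  have hwC : toReal n w ∈ cone S := toReal_mem_of_nsmul_mem hpe
    (by rw [h]; exact toReal_mem_cone (S.add_mem ht hb))
  have hF := isFace_minFace S (toReal n w)
  have hwF := PointedCone.self_mem_minFace hwC
  have hsum : toReal n t + toReal n b ∈ (cone S).minFace (toReal n w) := by
    rw [← map_add, ← h, toReal_nsmul]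
    exact PointedCone.smul_mem _ (Nat.cast_nonneg _) hwF
  have htF := hF.mem_of_add_mem_left (toReal_mem_cone ht) (toReal_mem_cone hb) hsum
  have hbF := hF.mem_of_add_mem_right (toReal_mem_cone ht) (toReal_mem_cone hb) hsum
  -- The minimal face of w contains b, so it is no p-face and its lattice contains w along with p ^
  -- e • w.
  refine hS.mem_of_mem_faceLattice hwC (hF.mem_faceLattice_of_pow_nsmul_mem hfg
    (fun hp => hoff _ hp hbF) hw (mem_spanPoints_of_mem hwF) (e := e) ?_)
  rw [h]
  exact add_mem (mem_faceLattice ht htF) (mem_faceLattice hb hbF)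

/-- If `u ∈ S` lies on no proper RUF, then for large `q` the lattice points `(t - v) / q + u` with
`t ∈ S` belong to `S`. -/
theorem IsSeminormal.eventually_mem_of_nsmul_eq (hS : IsSeminormal S) (hfg : S.FG)
    {u : Fin n → ℤ} (hu : u ∈ S) (hoff : ∀ D, IsProperRUF S D → toReal n u ∉ D)
    (v : Fin n → ℤ) :
    ∀ᶠ q : ℕ in atTop, ∀ t ∈ S, ∀ w ∈ lattice S, q • w = t + (q • u - v) → w ∈ S := by
  filter_upwards [eventually_toReal_mem_cone hfg v] with q hq t ht w hw h
  -- Here w - u = (t - v) / q. Once it lies in the cone, the minimal face of w contains u, so no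
  -- proper RUF contains that face.
  have hwu : toReal n w - toReal n u ∈ cone S := by
    rw [← map_sub]
    exact hq t ht (w - u) (by rw [smul_sub, h]; abel)
  have huC := toReal_mem_cone hu
  have hwC : toReal n w ∈ cone S := by simpa using (cone S).add_mem hwu huC
  have hF := isFace_minFace S (toReal n w)
  refine hS.mem_of_mem_faceLattice hwC (hF.mem_faceLattice_of_forall_not_isProperRUF hfg
    (fun D' hle hD' => hoff D' hD' (hle (PointedCone.mem_minFace_of_sub_mem huC hwu))) hw
    (mem_spanPoints_of_mem (PointedCone.self_mem_minFace hwC)))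

end AffineMonoidCone

namespace IsCartierFixed

/-! ### Formal properties of fixed ideals -/

variable {p : ℕ} {R : Type*} [CommRing R] {I J : Ideal R}

theorem map_mem (hI : IsCartierFixed p I) {e : ℕ} (he : 0 < e) (φ : CartierMap p R e) {x : R}
    (hx : x ∈ I) : φ.toFun x ∈ I := by
  unfold IsCartierFixed at hI
  rw [hI]
  have h : φ.image I ≤ ⨆ (e : ℕ) (_ : 0 < e) (φ : CartierMap p R e), φ.image I :=
    le_iSup_of_le e (le_iSup_of_le he (le_iSup_of_le φ le_rfl))
  exact h ⟨x, hx, rfl⟩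

theorem le_of_forall_map_mem (hI : IsCartierFixed p I)
    (h : ∀ (e : ℕ), 0 < e → ∀ φ : CartierMap p R e, ∀ x ∈ I, φ.toFun x ∈ J) : I ≤ J := by
  unfold IsCartierFixed at hI
  rw [hI]
  refine iSup_le fun e => iSup_le fun he => iSup_le fun φ => ?_
  rintro _ ⟨x, hx, rfl⟩
  exact h e he φ x hx

theorem of_forall (h : ∀ (e : ℕ), 0 < e → ∀ φ : CartierMap p R e, ∀ x ∈ I, φ.toFun x ∈ I)
    (h' : I ≤ ⨆ (e : ℕ) (_ : 0 < e) (φ : CartierMap p R e), φ.image I) : IsCartierFixed p I := by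
  refine le_antisymm h' (iSup_le fun e => iSup_le fun he => iSup_le fun φ => ?_)
  rintro _ ⟨x, hx, rfl⟩
  exact h e he φ x hx

end IsCartierFixed

namespace AffineMonoidCone

/-! ### Monomial ideals and Cartier maps of the monoid algebra -/

open AddMonoidAlgebra

variable {k : Type*} [Field k] {n : ℕ} {S : AddSubmonoid (Fin n → ℤ)}

theorem mem_ideal_of_forall_single_mem {I : Ideal (AddMonoidAlgebra k S)} {f : AddMonoidAlgebra k S}
    (h : ∀ v ∈ f.coeff.support, single v (1 : k) ∈ I) : f ∈ I := by
  rw [← sum_coeff_single f]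
  refine Ideal.sum_mem _ fun v hv => ?_
  have : single v (f.coeff v) = single 0 (f.coeff v) * single v (1 : k) := by
    rw [single_mul_single, zero_add, mul_one]
  rw [this]
  exact I.mul_mem_left _ (h v hv)

theorem single_one_mem {I : Ideal (AddMonoidAlgebra k S)} {v : S} {c : k} (hc : c ≠ 0)
    (h : single v c ∈ I) : single v (1 : k) ∈ I := by
  have : single v (1 : k) = single 0 c⁻¹ * single v c := by
    rw [single_mul_single, zero_add, inv_mul_cancel₀ hc]
  rw [this]
  exact I.mul_mem_left _ h

/-- By the face property, adding an element of S cannot move a point onto a face it is off, so these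
exponents form an ideal of the monoid S. -/
theorem mem_span_monomialsOff {P : PointedCone ℝ (Fin n → ℝ) → Prop}
    (hP : ∀ D, P D → IsFace S D) {f : AddMonoidAlgebra k S} :
    f ∈ Ideal.span (monomialsOff k S P) ↔
      ∀ u ∈ f.coeff.support, ∀ D, P D → toReal n (u : Fin n → ℤ) ∉ D := by
  constructor
  · intro hf
    have : monomialsOff k S P =
        AddMonoidAlgebra.of' k S '' {u | ∀ D, P D → toReal n (u : Fin n → ℤ) ∉ D} := by
      ext g
      exact ⟨fun ⟨u, hu, h⟩ => ⟨u, hu, h.symm⟩, fun ⟨u, hu, h⟩ => ⟨u, hu, h.symm⟩⟩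
    rw [this, AddMonoidAlgebra.mem_ideal_span_of'_image] at hf
    intro u hu D hD huD
    obtain ⟨v, hv, d, rfl⟩ := hf u hu
    refine hv D hD ((hP D hD).mem_of_add_mem_right (toReal_mem_cone d.2) (toReal_mem_cone v.2) ?_)
    rw [← map_add]
    exact huD
  · intro h
    exact mem_ideal_of_forall_single_mem fun v hv => Ideal.subset_span ⟨v, h v hv, rfl⟩

theorem restrictScalars_span_monomialsOff {P : PointedCone ℝ (Fin n → ℝ) → Prop}
    (hP : ∀ D, P D → IsFace S D) :
    (Ideal.span (monomialsOff k S P)).restrictScalars k =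
      Submodule.span k (monomialsOff k S P) := by
  apply le_antisymm
  · intro f hf
    have hf' := (mem_span_monomialsOff hP).1 hf
    rw [← sum_coeff_single f]
    refine Submodule.sum_mem _ fun v hv => ?_
    have : single v (f.coeff v) = f.coeff v • single v (1 : k) := by
      rw [smul_single, smul_eq_mul, mul_one]
    rw [this]
    exact Submodule.smul_mem _ _ (Submodule.subset_span ⟨v, hf' v hv, rfl⟩)
  · rw [Submodule.span_le]
    exact fun f hf => Ideal.subset_span hf

theorem exists_coeff_single_ne_zero (φ : AddMonoidAlgebra k S →+ AddMonoidAlgebra k S)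
    {f : AddMonoidAlgebra k S} {w : S} (h : (φ f).coeff w ≠ 0) :
    ∃ v ∈ f.coeff.support, (φ (single v (f.coeff v))).coeff w ≠ 0 := by
  by_contra! hcon
  apply h
  conv_lhs => rw [← sum_coeff_single f, Finsupp.sum, map_sum, coeff_sum, Finsupp.finsetSum_apply]
  exact Finset.sum_eq_zero hcon

/-- Let `m ∈ ⋂_{D ⊊ D'} M_{D'} ∩ ⟨D⟩` with `m ∉ M_D`. A Cartier map of level `e` sends the
monomials off `D`, and all monomials if `p ^ e • m ∈ M_D`, to elements with support off `D`. -/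
theorem IsSeminormal.coeff_cartierMap_single_eq_zero (hS : IsSeminormal S) (hfg : S.FG) {p e : ℕ}
    [hp : Fact p.Prime] (φ : CartierMap p (AddMonoidAlgebra k S) e)
    {D : PointedCone ℝ (Fin n → ℝ)} (hD : IsFace S D) {m : Fin n → ℤ} (hmS : m ∈ lattice S)
    (hm : m ∈ spanPoints D) (hmD' : ∀ D', IsFace S D' → D < D' → m ∈ faceLattice S D')
    (hmD : m ∉ faceLattice S D) {v w : S} (c : k)
    (hv : toReal n (v : Fin n → ℤ) ∈ D → p ^ e • m ∈ faceLattice S D)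
    (hw : toReal n (w : Fin n → ℤ) ∈ D) : (φ.toFun (single v c)).coeff w = 0 := by
  classical
  by_contra hne
  obtain ⟨s, hs, hsD, hmsD, hface⟩ := hD.exists_add_mem hfg hm
  have hpe : 0 < p ^ e := pow_pos hp.out.pos e
  set v' : Fin n → ℤ := v + p ^ e • (m + s) with hv'
  have hv'C : toReal n v' ∈ cone S := by
    rw [hv', map_add, toReal_nsmul]
    exact (cone S).add_mem (toReal_mem_cone v.2)
      ((cone S).smul_mem (Nat.cast_nonneg _) (hD.le hmsD))
  set F := (cone S).minFace (toReal n v') with hF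
  have hFf : IsFace S F := isFace_minFace S _
  have hsum : ((p ^ e : ℕ) : ℝ) • toReal n (m + s) + toReal n v ∈ F := by
    rw [← toReal_nsmul, ← map_add, add_comm]
    exact PointedCone.self_mem_minFace hv'C
  have hmsF : toReal n (m + s) ∈ F :=
    hFf.mem_of_smul_add_mem (hD.le hmsD) (toReal_mem_cone v.2) (by exact_mod_cast hpe) hsum
  have hvF : toReal n (v : Fin n → ℤ) ∈ F :=
    hFf.mem_of_add_mem_right ((cone S).smul_mem (Nat.cast_nonneg _) (hD.le hmsD))
      (toReal_mem_cone v.2) hsum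
  have hDF : D ≤ F := hface ▸ hFf.minFace_le hmsF
  -- If F = D then v is on D and the hypothesis on v applies; otherwise F is strictly larger and its
  -- lattice already contains m.
  have hpmF : p ^ e • m ∈ faceLattice S F := by
    rcases hDF.eq_or_lt with h | h
    · rw [← h]
      exact hv (h ▸ hvF)
    · exact nsmul_mem (hmD' F hFf h) _
  have hv'S : v' ∈ S := by
    refine hS.mem_of_mem_faceLattice hv'C ?_
    have h := add_mem (mem_faceLattice v.2 hvF)
      (add_mem hpmF (nsmul_mem (mem_faceLattice hs (hDF hsD)) (p ^ e)))
    rwa [← smul_add] at h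
  obtain ⟨a, ha, b, hb, rfl⟩ := exists_sub_of_mem_lattice hmS
  -- This is φ(x^{v'}) = x^{m+s} φ(x^v) with denominators cleared, as m + s need not lie in S.
  have hmul : single (⟨b, hb⟩ : S) (1 : k) * φ.toFun (single ⟨v', hv'S⟩ c) =
      single (⟨a + s, S.add_mem ha hs⟩ : S) (1 : k) * φ.toFun (single v c) := by
    rw [← φ.map_pow_mul, ← φ.map_pow_mul, single_pow, single_pow, single_mul_single,
      single_mul_single, one_pow]
    congr 2
    apply Subtype.ext
    change p ^ e • b + v' = p ^ e • (a + s) + v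
    rw [hv']
    simp only [smul_add, smul_sub]
    abel
  have hR : (single (⟨a + s, S.add_mem ha hs⟩ : S) (1 : k) * φ.toFun (single v c)).coeff
      (⟨a + s, S.add_mem ha hs⟩ + w) = (φ.toFun (single v c)).coeff w := by
    rw [coeff_single_mul_eq_mul_coeff w (fun m' _ => by simp), one_mul]
  rw [← hR, ← hmul] at hne
  have hex : ∃ d : S, (⟨b, hb⟩ : S) + d = ⟨a + s, S.add_mem ha hs⟩ + w := by
    by_contra! hcon
    exact hne (coeff_single_mul_of_forall_add_ne _ _ hcon)
  obtain ⟨d, hd⟩ := hex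
  have hd' : (d : Fin n → ℤ) = (a - b + s) + w := by
    have : b + (d : Fin n → ℤ) = a + s + w := congrArg Subtype.val hd
    rw [eq_comm, ← sub_eq_iff_eq_add'.2 this.symm]
    abel
  have hdD : toReal n (d : Fin n → ℤ) ∈ D := by
    rw [hd', map_add]
    exact D.add_mem hmsD hw
  apply hmD
  have : a - b = (d : Fin n → ℤ) - s - w := by rw [hd']; abel
  rw [this]
  exact sub_mem (sub_mem (mem_faceLattice d.2 hdD) (mem_faceLattice hs hsD))
    (mem_faceLattice w.2 hw)

/-- Cartier maps send everything into the span of the monomials off the `p`-faces. -/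
theorem IsSeminormal.not_isPFace_of_coeff_cartierMap_ne_zero (hS : IsSeminormal S) (hfg : S.FG)
    {p e : ℕ} [Fact p.Prime] (he : 0 < e) (φ : CartierMap p (AddMonoidAlgebra k S) e)
    {f : AddMonoidAlgebra k S} {w : S} (hw : (φ.toFun f).coeff w ≠ 0)
    (D : PointedCone ℝ (Fin n → ℝ)) (hD : IsPFace S p D) : toReal n (w : Fin n → ℤ) ∉ D := by
  intro hwD
  obtain ⟨D', hle, hD', m, hm, hmD', hmn, hpm⟩ := hD.exists_le hfg
  obtain ⟨v, -, hv⟩ := exists_coeff_single_ne_zero φ.toFun hw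
  have hlt : D' < cone S := lt_of_le_of_ne hD'.1.le fun h => not_isPFace_cone S p (h ▸ hD')
  refine hv (hS.coeff_cartierMap_single_eq_zero hfg φ hD'.1
    (faceLattice_cone S ▸ hmD' _ (isFace_cone S) hlt) hm hmD' hmn _ (fun _ => ?_) (hle hwD))
  obtain ⟨e, rfl⟩ := Nat.exists_eq_succ_of_ne_zero he.ne'
  rw [pow_succ, mul_smul]
  exact nsmul_mem hpm _

/-- Cartier maps preserve the span of the monomials off the proper RUFs. -/
theorem IsSeminormal.map_mem_span_monomialsOff_isProperRUF (hS : IsSeminormal S) (hfg : S.FG)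
    {p e : ℕ} [Fact p.Prime] (φ : CartierMap p (AddMonoidAlgebra k S) e)
    {f : AddMonoidAlgebra k S} (hf : f ∈ Ideal.span (monomialsOff k S (IsProperRUF S))) :
    φ.toFun f ∈ Ideal.span (monomialsOff k S (IsProperRUF S)) := by
  have hP : ∀ D, IsProperRUF S D → IsFace S D := fun D h => h.1.1
  rw [mem_span_monomialsOff hP] at hf ⊢
  intro w hw D hD hwD
  obtain ⟨v, hvs, hv⟩ := exists_coeff_single_ne_zero φ.toFun (Finsupp.mem_support_iff.1 hw)
  obtain ⟨m, hm, hmD', hmn⟩ := hD.exists_mem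
  refine hv (hS.coeff_cartierMap_single_eq_zero hfg φ hD.1.1
    (faceLattice_cone S ▸ hmD' _ (isFace_cone S) (lt_of_le_of_ne hD.1.1.le hD.2)) hm hmD' hmn _
    (fun h => absurd h (hf v hvs D hD)) hwD)

open Classical in
/-- The monomial Cartier map `x ^ t ↦ x ^ ((t + b) / p ^ e)`. -/
theorem exists_monomial_cartierMap {p : ℕ} [hp : Fact p.Prime] [CharP k p] [PerfectField k]
    (e : ℕ) (b : Fin n → ℤ)
    (hb : ∀ t ∈ S, ∀ w ∈ lattice S, p ^ e • w = t + b → w ∈ S) :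
    ∃ φ : CartierMap p (AddMonoidAlgebra k S) e,
      (∀ (t w : S) (c : k), p ^ e • (w : Fin n → ℤ) = t + b →
        φ.toFun (single t (c ^ p ^ e)) = single w c) ∧
      ∀ (t : S) (c : k), (∀ w : S, p ^ e • (w : Fin n → ℤ) ≠ t + b) →
        φ.toFun (single t c) = 0 := by
  have hchar : CharP (AddMonoidAlgebra k S) p :=
    charP_of_injective_algebraMap (algebraMap k (AddMonoidAlgebra k S)).injective p
  have hpe : p ^ e ≠ 0 := (pow_pos hp.out.pos e).ne'
  let root : k ≃+* k := (iterateFrobeniusEquiv k p e).symm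
  have hroot : ∀ c : k, root (c ^ p ^ e) = c := fun c => by
    rw [RingEquiv.symm_apply_eq]; rfl
  have hroot' : ∀ c : k, root c ^ p ^ e = c := fun c => by
    have : iterateFrobeniusEquiv k p e (root c) = c := RingEquiv.apply_symm_apply _ c
    exact this
  let ψ : S → k →+ AddMonoidAlgebra k S := fun t =>
    if h : ∃ w : S, p ^ e • (w : Fin n → ℤ) = t + b then
      (singleAddHom h.choose).comp root.toAddMonoidHom else 0
  let Φ : AddMonoidAlgebra k S →+ AddMonoidAlgebra k S :=
    (Finsupp.liftAddHom ψ).comp coeffAddEquiv.toAddMonoidHom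
  have hΦ : ∀ t c, Φ (single t c) = ψ t c := fun t c =>
    Finsupp.liftAddHom_apply_single ψ t c
  have hinj : ∀ w w' : Fin n → ℤ, p ^ e • w = p ^ e • w' → w = w' := fun w w' h =>
    smul_right_injective _ hpe h
  have hpos : ∀ (t w : S) (c : k), p ^ e • (w : Fin n → ℤ) = t + b →
      Φ (single t c) = single w (root c) := by
    intro t w c h
    have hex : ∃ w : S, p ^ e • (w : Fin n → ℤ) = t + b := ⟨w, h⟩
    have hw : hex.choose = w := Subtype.ext (hinj _ _ (hex.choose_spec.trans h.symm))
    rw [hΦ]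
    simp only [ψ, dif_pos hex]
    rw [hw]
    rfl
  have hneg : ∀ (t : S) (c : k), (∀ w : S, p ^ e • (w : Fin n → ℤ) ≠ t + b) →
      Φ (single t c) = 0 := by
    intro t c h
    rw [hΦ]
    simp only [ψ, dif_neg (not_exists.2 h)]
    rfl
  have hmon : ∀ (r t : S) (a c : k),
      Φ (single r a ^ p ^ e * single t c) = single r a * Φ (single t c) := by
    intro r t a c
    rw [single_pow, single_mul_single]
    by_cases h : ∃ w : S, p ^ e • (w : Fin n → ℤ) = t + b
    · obtain ⟨w, hw⟩ := h
      rw [hpos t w c hw, hpos _ (r + w) _ ?_, single_mul_single, map_mul, hroot]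
      change p ^ e • ((r : Fin n → ℤ) + w) = p ^ e • (r : Fin n → ℤ) + t + b
      rw [smul_add, hw, add_assoc]
    · push Not at h
      rw [hneg t c h, mul_zero]
      refine hneg _ _ fun w hw => ?_
      replace hw : p ^ e • (w : Fin n → ℤ) = p ^ e • (r : Fin n → ℤ) + t + b := hw
      have hw' : p ^ e • ((w : Fin n → ℤ) - r) = t + b := by
        rw [smul_sub, hw]; abel
      -- The hypothesis on b enters here: without it, x^r times a killed monomial might survive.
      have := hb t t.2 _ (sub_mem (AddSubgroup.subset_closure w.2)
        (AddSubgroup.subset_closure r.2)) hw'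
      exact h ⟨_, this⟩ hw'
  refine ⟨⟨Φ, fun r s => ?_⟩, fun t w c h => ?_, hneg⟩
  · induction s using AddMonoidAlgebra.induction_linear with
    | zero => simp
    | add f g hf hg => rw [mul_add, map_add, hf, hg, map_add, mul_add]
    | single t c =>
      induction r using AddMonoidAlgebra.induction_linear with
      | zero => rw [zero_pow hpe, zero_mul, map_zero, zero_mul]
      | add f g hf hg => rw [add_pow_char_pow, add_mul, map_add, hf, hg, add_mul]
      | single r a => exact hmon r t a c
  · change Φ _ = _
    rw [hpos t w _ h, hroot]

end AffineMonoidCone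

namespace AffineMonoidCone

/-! ### Structure of fixed ideals, the test ideal and the non-F-pure ideal -/

open AddMonoidAlgebra Filter

variable {k : Type*} [Field k] {n : ℕ} {S : AddSubmonoid (Fin n → ℤ)} {p : ℕ}

theorem not_mem_isPFace_nsmul {u : Fin n → ℤ} (hoff : ∀ D, IsPFace S p D → toReal n u ∉ D)
    {N : ℕ} (hN : 0 < N) : ∀ D, IsPFace S p D → toReal n (N • u) ∉ D :=
  fun D hD h => hoff D hD (toReal_mem_of_nsmul_mem hN h)

variable [hp : Fact p.Prime]

/-- The monomials off the `p`-RUFs are the monomials off the `p`-faces. -/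
theorem forall_isPRUF_not_mem_iff (hfg : S.FG) {x : Fin n → ℝ} :
    (∀ D, IsPRUF S p D → x ∉ D) ↔ ∀ D, IsPFace S p D → x ∉ D := by
  refine ⟨fun h D hD hx => ?_, fun h D hD => h D hD.2⟩
  obtain ⟨D', hle, hD', -⟩ := hD.exists_isPRUF hfg
  exact h D' hD' (hle hx)

theorem not_mem_isPFace_of_forall_isProperRUF (hfg : S.FG) {x : Fin n → ℝ}
    (h : ∀ D, IsProperRUF S D → x ∉ D) (D : PointedCone ℝ (Fin n → ℝ)) (hD : IsPFace S p D) :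
    x ∉ D := by
  intro hx
  obtain ⟨D', hle, -, hD'⟩ := hD.exists_isPRUF hfg
  exact h D' hD' (hle hx)

theorem not_isPFace_of_isCartierFixed (hS : IsSeminormal S) (hfg : S.FG)
    {I : Ideal (AddMonoidAlgebra k S)} (hI : IsCartierFixed p I) {f : AddMonoidAlgebra k S}
    (hf : f ∈ I) {v : S} (hv : v ∈ f.coeff.support) (D : PointedCone ℝ (Fin n → ℝ))
    (hD : IsPFace S p D) : toReal n (v : Fin n → ℤ) ∉ D := by
  have hP : ∀ D, IsPFace S p D → IsFace S D := fun D h => h.1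
  have hle : I ≤ Ideal.span (monomialsOff k S (IsPFace S p)) :=
    hI.le_of_forall_map_mem fun e he φ x _ => (mem_span_monomialsOff hP).2 fun w hw =>
      hS.not_isPFace_of_coeff_cartierMap_ne_zero hfg he φ (Finsupp.mem_support_iff.1 hw)
  exact (mem_span_monomialsOff hP).1 (hle hf) v hv D hD

variable [CharP k p] [PerfectField k]

/-- For `b ∈ S` off the `p`-faces there is the Cartier map `x ^ t ↦ x ^ ((t + b) / p ^ e)`. -/
theorem IsSeminormal.exists_monomial_cartierMap (hS : IsSeminormal S) (hfg : S.FG) (e : ℕ)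
    {b : Fin n → ℤ} (hb : b ∈ S) (hoff : ∀ D, IsPFace S p D → toReal n b ∉ D) :
    ∃ φ : CartierMap p (AddMonoidAlgebra k S) e,
      (∀ (t w : S) (c : k), p ^ e • (w : Fin n → ℤ) = t + b →
        φ.toFun (single t (c ^ p ^ e)) = single w c) ∧
      ∀ (t : S) (c : k), (∀ w : S, p ^ e • (w : Fin n → ℤ) ≠ t + b) →
        φ.toFun (single t c) = 0 :=
  AffineMonoidCone.exists_monomial_cartierMap e b fun _ ht _ hw h =>
    hS.mem_of_pow_nsmul_eq_add hfg hb hoff ht hw h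

/-- A monomial off the `p`-faces is fixed by some Cartier map. -/
theorem IsSeminormal.exists_cartierMap_single_eq_self (hS : IsSeminormal S) (hfg : S.FG) {v : S}
    (hoff : ∀ D, IsPFace S p D → toReal n (v : Fin n → ℤ) ∉ D) :
    ∃ φ : CartierMap p (AddMonoidAlgebra k S) 1,
      φ.toFun (single v (1 : k)) = single v 1 := by
  have hlt : 0 < p ^ 1 - 1 := by rw [pow_one]; exact Nat.sub_pos_of_lt hp.out.one_lt
  obtain ⟨φ, hφ, -⟩ := hS.exists_monomial_cartierMap (k := k) hfg 1
    (S.nsmul_mem v.2 (p ^ 1 - 1)) (not_mem_isPFace_nsmul hoff hlt)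
  refine ⟨φ, ?_⟩
  have := hφ v v 1 (by
    rw [← succ_nsmul', Nat.sub_add_cancel (Nat.pos_of_ne_zero (pow_ne_zero 1 hp.out.ne_zero))])
  rwa [one_pow] at this

/-- A sufficient condition for a monomial ideal off the `p`-faces to be fixed. -/
theorem IsSeminormal.isCartierFixed_of_forall (hS : IsSeminormal S) (hfg : S.FG)
    {I : Ideal (AddMonoidAlgebra k S)}
    (hmap : ∀ (e : ℕ), 0 < e → ∀ φ : CartierMap p (AddMonoidAlgebra k S) e,
      ∀ x ∈ I, φ.toFun x ∈ I)
    (hmon : ∀ f ∈ I, ∀ v ∈ f.coeff.support, single v (1 : k) ∈ I ∧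
      ∀ D, IsPFace S p D → toReal n (v : Fin n → ℤ) ∉ D) : IsCartierFixed p I := by
  refine .of_forall hmap fun f hf => mem_ideal_of_forall_single_mem fun v hv => ?_
  obtain ⟨hvI, hoff⟩ := hmon f hf v hv
  obtain ⟨φ, hφ⟩ := hS.exists_cartierMap_single_eq_self (k := k) hfg hoff
  have h : φ.image I ≤
      ⨆ (e : ℕ) (_ : 0 < e) (φ : CartierMap p (AddMonoidAlgebra k S) e), φ.image I :=
    le_iSup_of_le 1 (le_iSup_of_le one_pos (le_iSup_of_le φ le_rfl))
  exact h ⟨_, hvI, hφ⟩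

/-- Fixed ideals are monomial ideals. -/
theorem IsSeminormal.single_mem_of_isCartierFixed (hS : IsSeminormal S) (hfg : S.FG)
    {I : Ideal (AddMonoidAlgebra k S)} (hI : IsCartierFixed p I) {f : AddMonoidAlgebra k S}
    (hf : f ∈ I) {v : S} (hv : v ∈ f.coeff.support) : single v (1 : k) ∈ I := by
  classical
  have hoff := not_isPFace_of_isCartierFixed hS hfg hI hf hv
  -- B bounds all coordinate differences, so for p ^ e > B no other exponent of f is congruent to v
  -- modulo p ^ e.
  set B : ℕ := ∑ t ∈ f.coeff.support, ∑ i, ((t : Fin n → ℤ) i - (v : Fin n → ℤ) i).natAbs with hB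
  set e := B + 1 with he
  have hBe : B < p ^ e := (Nat.lt_succ_self B).trans (Nat.lt_pow_self hp.out.one_lt)
  have hlt : 0 < p ^ e - 1 := Nat.sub_pos_of_lt (Nat.one_lt_pow (by omega) hp.out.one_lt)
  have hsub : p ^ e • (v : Fin n → ℤ) = v + (p ^ e - 1) • (v : Fin n → ℤ) := by
    rw [← succ_nsmul', Nat.sub_add_cancel (by omega)]
  obtain ⟨φ, hφ, hφ0⟩ := hS.exists_monomial_cartierMap (k := k) hfg e
    (S.nsmul_mem v.2 (p ^ e - 1)) (not_mem_isPFace_nsmul hoff hlt)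
  have hzero : ∀ t ∈ f.coeff.support, t ≠ v → φ.toFun (single t (f.coeff t)) = 0 := by
    intro t ht htv
    refine hφ0 t _ fun w hw => htv (Subtype.ext (funext fun i => ?_))
    have h1 : p ^ e • ((w : Fin n → ℤ) - v) = t - v := by
      rw [smul_sub, hw, hsub]; abel
    have h2 := congrFun h1 i
    rw [Pi.smul_apply, Pi.sub_apply, Pi.sub_apply, nsmul_eq_mul] at h2
    have h3 : ((t : Fin n → ℤ) i - (v : Fin n → ℤ) i).natAbs < p ^ e := by
      refine lt_of_le_of_lt ?_ hBe
      refine (Finset.single_le_sum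
        (f := fun i => ((t : Fin n → ℤ) i - (v : Fin n → ℤ) i).natAbs)
        (fun _ _ => Nat.zero_le _) (Finset.mem_univ i)).trans ?_
      exact Finset.single_le_sum
        (f := fun t : S => ∑ i, ((t : Fin n → ℤ) i - (v : Fin n → ℤ) i).natAbs)
        (fun _ _ => Nat.zero_le _) ht
    have h4 := Int.eq_zero_of_dvd_of_natAbs_lt_natAbs (Dvd.intro _ h2) (by
      rw [Int.natAbs_natCast]; exact h3)
    exact sub_eq_zero.1 h4
  have hval : φ.toFun f = φ.toFun (single v (f.coeff v)) := by
    conv_lhs => rw [← sum_coeff_single f, Finsupp.sum, map_sum]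
    exact Finset.sum_eq_single_of_mem v hv hzero
  obtain ⟨c, hc⟩ : ∃ c : k, c ^ p ^ e = f.coeff v :=
    (iterateFrobeniusEquiv k p e).surjective (f.coeff v)
  have hc0 : c ≠ 0 := by
    rintro rfl
    rw [zero_pow (by omega)] at hc
    exact Finsupp.mem_support_iff.1 hv hc.symm
  have hmem := hI.map_mem (by omega) φ hf
  rw [hval, ← hc, hφ v v c hsub] at hmem
  exact single_one_mem hc0 hmem

/-- Fixed ideals are radical. -/
theorem IsSeminormal.isRadical_of_isCartierFixed (hS : IsSeminormal S) (hfg : S.FG)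
    {I : Ideal (AddMonoidAlgebra k S)} (hI : IsCartierFixed p I) : I.IsRadical := by
  classical
  have hchar : CharP (AddMonoidAlgebra k S) p :=
    charP_of_injective_algebraMap (algebraMap k (AddMonoidAlgebra k S)).injective p
  rintro f ⟨N, hN⟩
  have hpN : 0 < p ^ N := pow_pos hp.out.pos N
  have hfI : f ^ p ^ N ∈ I := I.pow_mem_of_pow_mem hN (Nat.lt_pow_self hp.out.one_lt).le
  refine mem_ideal_of_forall_single_mem fun v hv => ?_
  have hpow : f ^ p ^ N = ∑ t ∈ f.coeff.support, single (p ^ N • t) (f.coeff t ^ p ^ N) := by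
    conv_lhs => rw [← sum_coeff_single f, Finsupp.sum, sum_pow_char_pow]
    exact Finset.sum_congr rfl fun t _ => single_pow _ _ _
  have hinj : ∀ t : S, p ^ N • t = p ^ N • v → t = v := fun t h =>
    Subtype.ext (smul_right_injective _ hpN.ne' (congrArg Subtype.val h))
  have hcoeff : (f ^ p ^ N).coeff (p ^ N • v) = f.coeff v ^ p ^ N := by
    rw [hpow, coeff_sum, Finsupp.finsetSum_apply, Finset.sum_eq_single_of_mem v hv]
    · rw [coeff_single, Finsupp.single_apply, if_pos rfl]
    · intro t _ htv
      rw [coeff_single, Finsupp.single_apply, if_neg fun h => htv (hinj t h)]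
  have hsupp : p ^ N • v ∈ (f ^ p ^ N).coeff.support := by
    rw [Finsupp.mem_support_iff, hcoeff]
    exact pow_ne_zero _ (Finsupp.mem_support_iff.1 hv)
  have hoff : ∀ D, IsPFace S p D → toReal n (v : Fin n → ℤ) ∉ D := fun D hD h =>
    not_isPFace_of_isCartierFixed hS hfg hI hfI hsupp D hD (by
      change toReal n (p ^ N • (v : Fin n → ℤ)) ∈ D
      rw [toReal_nsmul]
      exact D.smul_mem (Nat.cast_nonneg _) h)
  -- Level N would require b = 0, which lies on every face; level N + 1 allows b = p^N(p-1)v, off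
  -- the p-faces like v, and still extracts x^v from x^{p^N v}.
  have hb : 0 < p ^ N * (p - 1) := Nat.mul_pos hpN (Nat.sub_pos_of_lt hp.out.one_lt)
  obtain ⟨φ, hφ, -⟩ := hS.exists_monomial_cartierMap (k := k) hfg (N + 1)
    (S.nsmul_mem v.2 (p ^ N * (p - 1))) (not_mem_isPFace_nsmul hoff hb)
  have hmem := hI.map_mem N.succ_pos φ (hS.single_mem_of_isCartierFixed hfg hI hfI hsupp)
  have := hφ (p ^ N • v) v 1 (by
    change p ^ (N + 1) • (v : Fin n → ℤ) = p ^ N • (v : Fin n → ℤ) + _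
    rw [← add_smul, ← mul_one_add, Nat.add_sub_cancel' hp.out.one_lt.le, pow_succ])
  rw [one_pow] at this
  rwa [this] at hmem

/-- Stability and monomiality pass to intersections; nonemptiness of the family keeps the supports
off the p-faces. -/
theorem IsSeminormal.isCartierFixed_sInf (hS : IsSeminormal S) (hfg : S.FG)
    {𝓘 : Set (Ideal (AddMonoidAlgebra k S))} (hne : 𝓘.Nonempty)
    (h : ∀ I ∈ 𝓘, IsCartierFixed p I) : IsCartierFixed p (sInf 𝓘) := by
  refine hS.isCartierFixed_of_forall hfg (fun e he φ x hx => ?_) fun f hf v hv => ⟨?_, ?_⟩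
  · rw [Submodule.mem_sInf] at hx ⊢
    exact fun I hI => (h I hI).map_mem he φ (hx I hI)
  · rw [Submodule.mem_sInf] at hf ⊢
    exact fun I hI => hS.single_mem_of_isCartierFixed hfg (h I hI) (hf I hI) hv
  · obtain ⟨I, hI⟩ := hne
    rw [Submodule.mem_sInf] at hf
    exact not_isPFace_of_isCartierFixed hS hfg (h I hI) (hf I hI) hv

theorem IsSeminormal.isTestIdeal_span_monomialsOff (hS : IsSeminormal S) (hfg : S.FG) :
    IsTestIdeal p (Ideal.span (monomialsOff k S (IsProperRUF S))) := by
  have hP : ∀ D, IsProperRUF S D → IsFace S D := fun D h => h.1.1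
  refine ⟨⟨?_, ?_⟩, ?_⟩
  -- An element of S whose minimal face is the whole cone lies on no proper face, which makes the
  -- ideal non-zero.
  · obtain ⟨s, hs, -, hCs⟩ := (isFace_cone S).exists_eq_minFace hfg
    have hmem : single (⟨s, hs⟩ : S) (1 : k) ∈ Ideal.span (monomialsOff k S (IsProperRUF S)) := by
      refine Ideal.subset_span ⟨⟨s, hs⟩, fun D hD hsD => hD.2 (le_antisymm hD.1.1.le ?_), rfl⟩
      rw [hCs]
      exact hD.1.1.minFace_le hsD
    intro h
    rw [h, Ideal.mem_bot, single_eq_zero] at hmem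
    exact one_ne_zero hmem
  · refine hS.isCartierFixed_of_forall hfg
      (fun e _ φ x hx => hS.map_mem_span_monomialsOff_isProperRUF hfg φ hx)
      fun f hf v hv => ?_
    have hoff := (mem_span_monomialsOff hP).1 hf v hv
    exact ⟨Ideal.subset_span ⟨v, hoff, rfl⟩, not_mem_isPFace_of_forall_isProperRUF hfg hoff⟩
  · rintro I ⟨hI0, hI⟩
    rw [Ideal.span_le]
    rintro _ ⟨u, hu, rfl⟩
    obtain ⟨f, hf, hf0⟩ := Submodule.exists_mem_ne_zero_of_ne_bot hI0
    obtain ⟨v, hv⟩ := Finsupp.support_nonempty_iff.2 (mt coeff_eq_zero.1 hf0)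
    have hvI := hS.single_mem_of_isCartierFixed hfg hI hf hv
    -- For large e the shift b = p ^ e • u - v is admissible although it need not lie in S.
    obtain ⟨e, he, he0⟩ := (((tendsto_pow_atTop_atTop_of_one_lt hp.out.one_lt).eventually
      (hS.eventually_mem_of_nsmul_eq hfg u.2 hu v)).and (eventually_gt_atTop 0)).exists
    obtain ⟨φ, hφ, -⟩ := AffineMonoidCone.exists_monomial_cartierMap (k := k) e _ he
    have hmem := hI.map_mem he0 φ hvI
    have := hφ v u 1 (by abel)
    rw [one_pow] at this
    rwa [this] at hmem

theorem IsSeminormal.isNonFPureIdeal_span_monomialsOff (hS : IsSeminormal S) (hfg : S.FG) :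
    IsNonFPureIdeal p (Ideal.span (monomialsOff k S (IsPRUF S p))) := by
  have hP : ∀ D, IsPRUF S p D → IsFace S D := fun D h => h.1.1
  refine ⟨?_, fun I hI f hf => (mem_span_monomialsOff hP).2 fun u hu =>
    (forall_isPRUF_not_mem_iff hfg).2 (not_isPFace_of_isCartierFixed hS hfg hI hf hu)⟩
  refine hS.isCartierFixed_of_forall hfg (fun e he φ x _ => ?_) fun f hf v hv => ?_
  · exact (mem_span_monomialsOff hP).2 fun w hw => (forall_isPRUF_not_mem_iff hfg).2
      (hS.not_isPFace_of_coeff_cartierMap_ne_zero hfg he φ (Finsupp.mem_support_iff.1 hw))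
  · have hoff := (mem_span_monomialsOff hP).1 hf v hv
    exact ⟨Ideal.subset_span ⟨v, hoff, rfl⟩, (forall_isPRUF_not_mem_iff hfg).1 hoff⟩

end AffineMonoidCone

theorem corollary1p3 (p : ℕ) [Fact p.Prime] (k : Type*) [Field k] [CharP k p] [PerfectField k]
    (n : ℕ) (S : AddSubmonoid (Fin n → ℤ)) (hfg : S.FG) (hS : AffineMonoidCone.IsSeminormal S) :
    -- the `𝒞`-fixed ideals are radical and closed under intersection
    ((∀ I : Ideal (AddMonoidAlgebra k S), IsCartierFixed p I → I.IsRadical) ∧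
      (∀ 𝓘 : Set (Ideal (AddMonoidAlgebra k S)), 𝓘.Nonempty →
        (∀ I ∈ 𝓘, IsCartierFixed p I) → IsCartierFixed p (sInf 𝓘))) ∧
    -- the test ideal
    (∃ τ : Ideal (AddMonoidAlgebra k S), IsTestIdeal p τ ∧
      τ = Ideal.span (AffineMonoidCone.monomialsOff k S (AffineMonoidCone.IsProperRUF S)) ∧
      τ.restrictScalars k = Submodule.span k
        (AffineMonoidCone.monomialsOff k S (AffineMonoidCone.IsProperRUF S))) ∧
    -- the non-F-pure ideal
    (∃ σ : Ideal (AddMonoidAlgebra k S), IsNonFPureIdeal p σ ∧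
      σ = Ideal.span (AffineMonoidCone.monomialsOff k S (AffineMonoidCone.IsPRUF S p)) ∧
      σ.restrictScalars k = Submodule.span k
        (AffineMonoidCone.monomialsOff k S (AffineMonoidCone.IsPRUF S p))) := by
  refine ⟨⟨fun I hI => hS.isRadical_of_isCartierFixed hfg hI,
    fun 𝓘 hne h => hS.isCartierFixed_sInf hfg hne h⟩,
    ⟨_, hS.isTestIdeal_span_monomialsOff hfg, rfl,
      AffineMonoidCone.restrictScalars_span_monomialsOff fun D h => h.1.1⟩,
    ⟨_, hS.isNonFPureIdeal_span_monomialsOff hfg, rfl,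
      AffineMonoidCone.restrictScalars_span_monomialsOff fun D h => h.1.1⟩⟩
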